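/- For every $q\in(2,\infty)$ there exists a subset $Z$ of the real sequence space $\ell_q$ such that $Z$, with the metric induced by the $\ell_q$-norm, is doubling (there is $N\in\mathbb N$ such that for every $r>0$ every ball of radius $r$ in $Z$ can be covered by at most $N$ balls of $Z$ of radius $r/2$), and such that for every $d\in\mathbb N$ the set $Z$ admits no bi-Lipschitz embedding into the Euclidean space $\mathbb R^d$; that is, for no $d\in\mathbb N$ are there a map $f\colon Z\to\mathbb R^d$ and constants $s>0$, $D\ge 1$ with $s\|x-y\|_q\le \|f(x)-f(y)\|_2\le D\,s\,\|x-y\|_q$ for all $x,y\in Z$. -/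

import Mathlib

open scoped ENNReal

/-- A metric space is doubling if there is a number `N` such that every ball of radius `r` can be
covered by at most `N` balls of radius `r / 2`. A subset of a metric space is doubling if it is
doubling with the induced metric, so that the centres of all these balls lie in the subset. -/
def IsDoubling (X : Type*) [MetricSpace X] : Prop :=
  ∃ N : ℕ, ∀ (x : X) (r : ℝ), 0 < r →
    ∃ c : Finset X, c.card ≤ N ∧ Metric.closedBall x r ⊆ ⋃ y ∈ c, Metric.closedBall y (r / 2)

/-- `f` is a bi-Lipschitz embedding: for some scaling factor `s > 0` and some distortion `D ≥ 1`,
all distances satisfy `s * dist x y ≤ dist (f x) (f y) ≤ D * s * dist x y`. -/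
def IsBiLipschitzEmbedding {X Y : Type*} [MetricSpace X] [MetricSpace Y] (f : X → Y) : Prop :=
  ∃ s D : ℝ, 0 < s ∧ 1 ≤ D ∧
    ∀ x y : X, s * dist x y ≤ dist (f x) (f y) ∧ dist (f x) (f y) ≤ D * s * dist x y

/-! `Z` consists of the points with first coordinate `h` and further coordinates `± eps k * tent k
h`, all signs being free: a diamond-like space whose branches of level `k` split and meet again
within each interval of length `4⁻ᵏ`.

No inner product space contains a bi-Lipschitz copy. At level `k` two branches form a quadrilateral,
and the inequality between its sides and diagonals makes the squared stretch of an edge drop by at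
least a multiple of `eps k ^ 2` below the bound for the next finer scale (`norm_sq_edge_le`). Since
`∑ eps k ^ 2` is harmonic, the bound becomes negative. Only `∑ eps k ^ q < ∞` is needed to stay in
`ℓ_q`, hence `q > 2`.

For doubling, a point of an `r`-ball is determined up to `r / 2` by its rounded height and four
signs. Fine levels contribute little, three intermediate signs are recorded, and among coarse levels
only one sign is undetermined (`exists_level_forall_constant`): the kinks of a coarse tent lie where
every finer tent vanishes. -/

/-! ### Distance to the nearest integer. -/

/-- The distance from a real number to the nearest integer. -/
noncomputable def distInt (x : ℝ) : ℝ := |x - round x|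

lemma distInt_sub_le (x y : ℝ) : |distInt x - distInt y| ≤ |x - y| := by
  unfold distInt
  rw [abs_le]
  have h₁ := round_le x (round y)
  have h₂ := round_le y (round x)
  have h₃ := abs_sub_abs_le_abs_sub (x - round y) (y - round y)
  have h₄ := abs_sub_abs_le_abs_sub (y - round x) (x - round x)
  rw [show x - round y - (y - round y) = x - y by ring] at h₃
  rw [show y - round x - (x - round x) = y - x by ring, abs_sub_comm y x] at h₄
  constructor <;> linarith

lemma distInt_le_abs_sub (x : ℝ) (z : ℤ) : distInt x ≤ |x - z| := round_le x z

lemma distInt_add_int (x : ℝ) (z : ℤ) : distInt (z + x) = distInt x := by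
  simp [distInt]

lemma distInt_eq_self {x : ℝ} (h₀ : 0 ≤ x) (h₁ : x < 1 / 2) : distInt x = x := by
  have : round x = 0 := round_eq_zero_iff.2 ⟨by linarith, h₁⟩
  simp [distInt, this, abs_of_nonneg h₀]

lemma distInt_neg_le (x : ℝ) : distInt (-x) ≤ distInt x := by
  have h := distInt_le_abs_sub (-x) (-round x)
  have e : -x - ((-round x : ℤ) : ℝ) = -(x - round x) := by push_cast; ring
  rwa [e, abs_neg] at h

lemma distInt_neg (x : ℝ) : distInt (-x) = distInt x :=
  le_antisymm (distInt_neg_le x) (by simpa using distInt_neg_le (-x))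

/-- If `4 m a` is far from the integers, then `a` is far from the points at distance `1 / 4` from
the integers. -/
lemma one_le_mul_abs_distInt_sub {m : ℕ} {a : ℝ} (h : 1 / 4 < distInt (4 * m * a)) :
    1 / 4 ≤ 4 * m * |distInt a - 1 / 4| := by
  rcases abs_choice (a - round a) with ha | ha
  -- The points `round a ± 1 / 4` become integers after multiplication by `4 * m`.
  · refine h.le.trans ((distInt_le_abs_sub _ (4 * m * round a + m)).trans_eq ?_)
    rw [distInt, ha, ← abs_of_nonneg (show (0 : ℝ) ≤ 4 * m by positivity), ← abs_mul]
    rw [abs_of_nonneg (show (0 : ℝ) ≤ 4 * m by positivity)]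
    congr 1; push_cast; ring
  · refine h.le.trans ((distInt_le_abs_sub _ (4 * m * round a - m)).trans_eq ?_)
    rw [distInt, ha, ← abs_of_nonneg (show (0 : ℝ) ≤ 4 * m by positivity), ← abs_mul]
    rw [abs_of_nonneg (show (0 : ℝ) ≤ 4 * m by positivity), ← abs_neg]
    congr 1; push_cast; ring

/-! ### Tent functions. -/

/-- The periodic tent function of scale `4⁻ᵏ`: it vanishes at distance at most `4⁻ᵏ / 4` from
`4⁻ᵏ ℤ` and has slopes `± 1` elsewhere. -/
noncomputable def tent (k : ℕ) (h : ℝ) : ℝ := (4 ^ k)⁻¹ * max 0 (distInt (4 ^ k * h) - 1 / 4)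

lemma tent_nonneg (k : ℕ) (h : ℝ) : 0 ≤ tent k h := by unfold tent; positivity

lemma tent_le (k : ℕ) (h : ℝ) : tent k h ≤ (4 ^ k)⁻¹ / 4 := by
  have h₁ : max 0 (distInt (4 ^ k * h) - 1 / 4) ≤ 1 / 4 :=
    max_le (by norm_num) (by have := abs_sub_round (4 ^ k * h); unfold distInt; linarith)
  have := mul_le_mul_of_nonneg_left h₁ (show (0 : ℝ) ≤ (4 ^ k)⁻¹ by positivity)
  unfold tent; linarith

lemma abs_tent_sub_le (k : ℕ) (x y : ℝ) : |tent k x - tent k y| ≤ |x - y| := by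
  have h₁ := abs_max_sub_max_le_abs (distInt (4 ^ k * x) - 1 / 4) (distInt (4 ^ k * y) - 1 / 4) 0
  have h₂ := distInt_sub_le (4 ^ k * x) (4 ^ k * y)
  rw [← mul_sub, abs_mul, abs_of_pos (show (0 : ℝ) < 4 ^ k by positivity)] at h₂
  rw [sub_sub_sub_cancel_right] at h₁
  have h₃ := mul_le_mul_of_nonneg_left (h₁.trans h₂) (show (0 : ℝ) ≤ (4 ^ k)⁻¹ by positivity)
  rw [inv_mul_cancel_left₀ (by positivity)] at h₃
  unfold tent
  rw [← mul_sub, abs_mul, abs_of_pos (show (0 : ℝ) < (4 ^ k)⁻¹ by positivity),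
    max_comm 0, max_comm 0]
  exact h₃

lemma tent_zero_right (k : ℕ) : tent k 0 = 0 := by
  simp [tent, distInt]

lemma tent_eq_zero {k : ℕ} {h : ℝ} (hh : distInt (4 ^ k * h) ≤ 1 / 4) : tent k h = 0 := by
  rw [tent, max_eq_left (by linarith), mul_zero]

/-- If the tent function of a finer scale `4⁻ʲ` does not vanish at `y`, then near `y` the tent
function of scale `4⁻ⁱ` either vanishes or is large. -/
lemma tent_eq_zero_or_le {i j : ℕ} (hij : i < j) {y z : ℝ} (hy : tent j y ≠ 0) :
    (|z - y| ≤ (4 ^ j)⁻¹ / 4 → tent i z = 0) ∨ (4 ^ j)⁻¹ / 4 ≤ tent i y := by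
  have hj : 1 / 4 < distInt (4 ^ j * y) := by
    by_contra! h; exact hy (tent_eq_zero h)
  obtain ⟨n, rfl⟩ := Nat.exists_eq_add_of_lt hij
  have h4 : (4 : ℝ) ^ (i + n + 1) = 4 * (4 ^ n : ℕ) * 4 ^ i := by push_cast; ring
  rw [h4, mul_assoc] at hj
  have key := one_le_mul_abs_distInt_sub hj
  have hi : (0 : ℝ) < 4 ^ i := by positivity
  have hn : (0 : ℝ) < 4 * (4 ^ n : ℕ) := by positivity
  rw [h4]
  set N : ℝ := 4 * (4 ^ n : ℕ)
  have key' : N⁻¹ / 4 ≤ |distInt (4 ^ i * y) - 1 / 4| := by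
    rw [inv_eq_one_div, div_div, div_le_iff₀ (by positivity)]; linarith
  rcases le_abs'.1 key' with h | h
  · left
    intro hz
    apply tent_eq_zero
    have h₂ := (le_abs_self _).trans (distInt_sub_le (4 ^ i * z) (4 ^ i * y))
    rw [← mul_sub, abs_mul, abs_of_pos hi] at h₂
    have h₃ := mul_le_mul_of_nonneg_left hz hi.le
    rw [mul_inv, show (4 : ℝ) ^ i * (N⁻¹ * (4 ^ i)⁻¹ / 4) = N⁻¹ / 4 by field_simp] at h₃
    linarith
  · right
    unfold tent
    rw [mul_inv, mul_comm N⁻¹, mul_div_assoc]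
    gcongr
    exact h.trans (le_max_right _ _)

lemma tent_int_add {k : ℕ} (a : ℤ) (x : ℝ) : tent k ((a + x) / 4 ^ k) = tent k (x / 4 ^ k) := by
  unfold tent
  rw [mul_div_cancel₀ _ (by positivity), mul_div_cancel₀ _ (by positivity), distInt_add_int]

/-! ### The points of the example in `ℓ_q`. -/

/-- A sequence in `ℓ_q` for all `q > 2`, but not in `ℓ_2`. -/
noncomputable def eps (k : ℕ) : ℝ := (√(k + 1))⁻¹

lemma eps_pos (k : ℕ) : 0 < eps k := by unfold eps; positivity

lemma eps_antitone : Antitone eps := fun i j h => by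
  unfold eps; gcongr

lemma eps_le_one (k : ℕ) : eps k ≤ 1 := by
  simpa [eps] using eps_antitone (Nat.zero_le k)

lemma eps_sq (k : ℕ) : eps k ^ 2 = 1 / ((k : ℝ) + 1) := by
  rw [eps, inv_pow, Real.sq_sqrt (by positivity), one_div]

/-- The sequence `eps` preceded by `1`. -/
noncomputable def weight : ℕ → ℝ
  | 0 => 1
  | k + 1 => eps k

lemma weight_nonneg (n : ℕ) : 0 ≤ weight n := by
  cases n with
  | zero => exact zero_le_one
  | succ k => exact (eps_pos k).le

/-- The series is `∑ (k + 1) ^ (-q / 2)`, convergent because `q / 2 > 1`. -/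
lemma memℓp_weight {q : ℝ≥0∞} (hq : 2 < q) (hq' : q < ∞) : Memℓp weight q := by
  have h2 : 2 < q.toReal := by
    simpa using (ENNReal.toReal_lt_toReal (by simp) hq'.ne).2 hq
  refine memℓp_gen ((summable_nat_add_iff 1).1 ?_)
  have hs := (summable_nat_add_iff 1).2
    (Real.summable_nat_rpow_inv (p := q.toReal / 2) |>.2 (by linarith))
  refine hs.congr fun k => ?_
  rw [weight, Real.norm_of_nonneg (eps_pos k).le, eps, Real.inv_rpow (Real.sqrt_nonneg _),
    Real.sqrt_eq_rpow, ← Real.rpow_mul (by positivity)]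
  push_cast
  congr 2; ring

/-- The sign encoded by a Boolean. -/
def boolSign (b : Bool) : ℝ := if b then 1 else -1

lemma abs_boolSign (b : Bool) : |boolSign b| = 1 := by
  cases b <;> simp [boolSign]

/-- The point of height `h` and with signs `σ`: the height is the first coordinate, and the other
coordinates are signed weighted tent functions of the height. -/
noncomputable def coords (h : ℝ) (σ : ℕ → Bool) : ℕ → ℝ
  | 0 => h
  | k + 1 => boolSign (σ k) * (eps k * tent k h)

lemma abs_coords_sub_le (x y : ℝ) (σ : ℕ → Bool) (n : ℕ) :
    |coords x σ n - coords y σ n| ≤ |x - y| * weight n := by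
  cases n with
  | zero => simp [coords, weight]
  | succ k =>
    simp only [coords, weight]
    rw [← mul_sub, ← mul_sub, abs_mul, abs_mul, abs_boolSign, abs_of_pos (eps_pos k), one_mul,
      mul_comm]
    exact mul_le_mul_of_nonneg_right (abs_tent_sub_le k x y) (eps_pos k).le

lemma memℓp_coords {q : ℝ≥0∞} (hq : 2 < q) (hq' : q < ∞) (h : ℝ) (σ : ℕ → Bool) :
    Memℓp (coords h σ) q := by
  refine ((memℓp_weight hq hq').const_mul |h|).mono fun n => ?_
  have h0 : coords 0 σ n = 0 := by cases n <;> simp [coords, tent_zero_right]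
  simpa [h0] using abs_coords_sub_le h 0 σ n

/-- The sequence `coords h σ` as an element of `ℓ_q`. -/
noncomputable def point {q : ℝ≥0∞} (hq : 2 < q) (hq' : q < ∞) (h : ℝ) (σ : ℕ → Bool) :
    lp (fun _ : ℕ => ℝ) q :=
  ⟨coords h σ, memℓp_coords hq hq' h σ⟩

/-- The sequence `weight` as an element of `ℓ_q`. -/
noncomputable def weightLp {q : ℝ≥0∞} (hq : 2 < q) (hq' : q < ∞) : lp (fun _ : ℕ => ℝ) q :=
  ⟨weight, memℓp_weight hq hq'⟩

lemma abs_apply_sub_le_dist {q : ℝ≥0∞} [Fact (1 ≤ q)] (hq : 2 < q)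
    (x y : lp (fun _ : ℕ => ℝ) q) (n : ℕ) : |x n - y n| ≤ dist x y := by
  rw [dist_eq_norm]
  exact lp.norm_apply_le_norm (pos_of_gt hq).ne' (x - y) n

lemma dist_point_le {q : ℝ≥0∞} [Fact (1 ≤ q)] (hq : 2 < q) (hq' : q < ∞)
    (x y : ℝ) (σ : ℕ → Bool) :
    dist (point hq hq' x σ) (point hq hq' y σ) ≤ |x - y| * ‖weightLp hq hq'‖ := by
  rw [dist_eq_norm, ← abs_abs (x - y), ← Real.norm_eq_abs |x - y|,
    ← lp.norm_const_smul (pos_of_gt hq).ne']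
  refine lp.norm_mono (pos_of_gt hq).ne' fun n => ?_
  refine (abs_coords_sub_le x y σ n).trans ((le_abs_self _).trans_eq ?_)
  rw [abs_mul, abs_abs]
  simp [weightLp]

lemma le_dist_point {q : ℝ≥0∞} [Fact (1 ≤ q)] (hq : 2 < q) (hq' : q < ∞)
    (h : ℝ) (σ : ℕ → Bool) (k : ℕ) :
    2 * eps k * tent k h ≤ dist (point hq hq' h (Function.update σ k true))
      (point hq hq' h (Function.update σ k false)) := by
  refine le_trans (le_trans (le_of_eq ?_) (le_abs_self _)) (abs_apply_sub_le_dist hq _ _ (k + 1))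
  simp [point, coords, boolSign]; ring

/-- This glues the two branches of level `k` together wherever their tent vanishes. -/
lemma point_update {q : ℝ≥0∞} (hq : 2 < q) (hq' : q < ∞)
    (h : ℝ) (σ : ℕ → Bool) (k : ℕ) (b : Bool) (hk : tent k h = 0) :
    point hq hq' h (Function.update σ k b) = point hq hq' h σ := by
  ext n
  cases n with
  | zero => rfl
  | succ i =>
    by_cases hi : i = k
    · subst hi; simp [point, coords, hk]
    · simp [point, coords, Function.update_of_ne hi]

/-! ### Nonembedding into inner product spaces. -/

section Nonembedding

variable {E : Type*} [NormedAddCommGroup E] [InnerProductSpace ℝ E]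

/-- The squares of the diagonals of a quadrilateral add up to at most those of the sides. -/
lemma norm_sq_diagonals_le (a b c d : E) :
    ‖c - a‖ ^ 2 + ‖b - d‖ ^ 2 ≤ ‖b - a‖ ^ 2 + ‖c - b‖ ^ 2 + ‖d - c‖ ^ 2 + ‖a - d‖ ^ 2 := by
  have h := sq_nonneg ‖(b - a) + (d - c)‖
  have h₁ : c - a = (b - a) + (c - b) := by abel
  have h₂ : b - d = -((c - b) + (d - c)) := by abel
  have h₃ : a - d = -((b - a) + (c - b) + (d - c)) := by abel
  rw [h₁, h₂, h₃, norm_neg, norm_neg]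
  simp only [norm_add_sq_real, inner_add_left] at h ⊢
  linarith

/-- If a path `u, a, c, v` bypasses the quadrilateral `a, b, c, d`, then its ends are closer
than the sides of the path and of the quadrilateral suggest. -/
lemma norm_sq_le_of_quadrilateral {u a b c d v : E} {T δ : ℝ} (hδ : 0 ≤ δ)
    (hua : ‖a - u‖ ^ 2 ≤ T) (hab : ‖b - a‖ ^ 2 ≤ T) (hbc : ‖c - b‖ ^ 2 ≤ T)
    (had : ‖d - a‖ ^ 2 ≤ T) (hdc : ‖c - d‖ ^ 2 ≤ T) (hcv : ‖v - c‖ ^ 2 ≤ T)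
    (hbd : δ ≤ ‖b - d‖) : ‖v - u‖ ^ 2 ≤ 16 * T - 2 * δ ^ 2 := by
  have h := norm_sq_diagonals_le a b c d
  rw [norm_sub_rev d c, norm_sub_rev a d] at h
  have h₁ : ‖v - u‖ ≤ ‖a - u‖ + ‖c - a‖ + ‖v - c‖ := by
    rw [show v - u = (a - u) + (c - a) + (v - c) by abel]
    exact norm_add₃_le
  have h₂ : ‖v - u‖ ^ 2 ≤ (‖a - u‖ + ‖c - a‖ + ‖v - c‖) ^ 2 := by gcongr
  have h₃ : δ ^ 2 ≤ ‖b - d‖ ^ 2 := by gcongr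
  -- Cauchy–Schwarz with weights 1, 2, 1: `(p + t + w)² ≤ 4p² + 2t² + 4w²`, where `t² ≤ 4T - δ²` by
  -- the diagonal inequality.
  nlinarith [sq_nonneg (‖c - a‖ - 2 * ‖a - u‖), sq_nonneg (‖c - a‖ - 2 * ‖v - c‖),
    sq_nonneg (‖a - u‖ - ‖v - c‖)]

lemma tent_quarter {k : ℕ} (a : ℤ) : tent k ((4 * a + 1 : ℤ) / 4 ^ (k + 1)) = 0 := by
  have : (((4 * a + 1 : ℤ) : ℝ) / 4 ^ (k + 1)) = (a + 1 / 4) / 4 ^ k := by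
    push_cast; field_simp; ring
  rw [this, tent_int_add]
  apply tent_eq_zero
  rw [mul_div_cancel₀ _ (by positivity), distInt_eq_self] <;> norm_num

lemma tent_three_quarters {k : ℕ} (a : ℤ) : tent k ((4 * a + 3 : ℤ) / 4 ^ (k + 1)) = 0 := by
  have : (((4 * a + 3 : ℤ) : ℝ) / 4 ^ (k + 1)) = ((a + 1 : ℤ) + -(1 / 4)) / 4 ^ k := by
    push_cast; field_simp; ring
  rw [this, tent_int_add]
  apply tent_eq_zero
  rw [mul_div_cancel₀ _ (by positivity), distInt_neg, distInt_eq_self] <;> norm_num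

lemma tent_half {k : ℕ} (a : ℤ) : tent k ((4 * a + 2 : ℤ) / 4 ^ (k + 1)) = (4 ^ k)⁻¹ / 4 := by
  have : (((4 * a + 2 : ℤ) : ℝ) / 4 ^ (k + 1)) = (a + 1 / 2) / 4 ^ k := by
    push_cast; field_simp; ring
  have h : distInt (1 / 2) = 1 / 2 := by
    rw [distInt, one_div, round_two_inv]; norm_num
  rw [this, tent_int_add, tent, mul_div_cancel₀ _ (by positivity), h]
  norm_num; ring

/-- A map into a Euclidean space that is Lipschitz and does not contract the points of the form
`point h σ` too much stretches the distances at coarse scales less than those at fine scales. -/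
lemma norm_sq_edge_le {q : ℝ≥0∞} [Fact (1 ≤ q)] (hq : 2 < q) (hq' : q < ∞)
    (g : lp (fun _ : ℕ => ℝ) q → E) {s A : ℝ} (hs : 0 < s) (hA : 0 ≤ A)
    (hl : ∀ h σ h' σ', s * dist (point hq hq' h σ) (point hq hq' h' σ') ≤
      ‖g (point hq hq' h σ) - g (point hq hq' h' σ')‖)
    (hu : ∀ h σ h' σ', ‖g (point hq hq' h σ) - g (point hq hq' h' σ')‖ ≤
      A * dist (point hq hq' h σ) (point hq hq' h' σ')) (n : ℕ) :
    ∀ (k : ℕ) (a : ℤ) (σ : ℕ → Bool),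
      16 ^ k * ‖g (point hq hq' ((a + 1 : ℤ) / 4 ^ k) σ) - g (point hq hq' (a / 4 ^ k) σ)‖ ^ 2 ≤
        (A * ‖weightLp hq hq'‖) ^ 2 - s ^ 2 / 2 * ∑ i ∈ Finset.range n, eps (k + i) ^ 2 := by
  induction n with
  | zero =>
    intro k a σ
    have h := (hu ((a + 1 : ℤ) / 4 ^ k) σ (a / 4 ^ k) σ).trans
      (mul_le_mul_of_nonneg_left (dist_point_le hq hq' _ _ σ) hA)
    have e : ((a + 1 : ℤ) : ℝ) / 4 ^ k - a / 4 ^ k = (4 ^ k)⁻¹ := by push_cast; field_simp; ring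
    rw [e, abs_of_pos (by positivity)] at h
    calc _ ≤ (16 : ℝ) ^ k * (A * ((4 ^ k)⁻¹ * ‖weightLp hq hq'‖)) ^ 2 := by gcongr
      _ = _ := by
        rw [show (16 : ℝ) ^ k = 4 ^ k * 4 ^ k by rw [← mul_pow]; norm_num]
        field_simp
        simp
  | succ n ih =>
    intro k a σ
    -- The term split off is the one at `i = 0`, since the induction hypothesis is used at level `k
    -- + 1`.
    rw [Finset.sum_range_succ']
    have hidx : ∑ i ∈ Finset.range n, eps (k + (i + 1)) ^ 2 =
        ∑ i ∈ Finset.range n, eps (k + 1 + i) ^ 2 :=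
      Finset.sum_congr rfl fun i _ => by rw [show k + (i + 1) = k + 1 + i by ring]
    rw [hidx, add_zero]
    set B := (A * ‖weightLp hq hq'‖) ^ 2 - s ^ 2 / 2 * ∑ i ∈ Finset.range n, eps (k + 1 + i) ^ 2
      with hB
    have h16 : (0 : ℝ) < 16 ^ (k + 1) := by positivity
    have edge : ∀ (m m' : ℤ) (τ : ℕ → Bool), m' = m + 1 →
        ‖g (point hq hq' (m' / 4 ^ (k + 1)) τ) - g (point hq hq' (m / 4 ^ (k + 1)) τ)‖ ^ 2 ≤
          B / 16 ^ (k + 1) := by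
      rintro m _ τ rfl
      rw [le_div_iff₀ h16, mul_comm]
      exact ih (k + 1) m τ
    have hd := (mul_le_mul_of_nonneg_left (le_dist_point hq hq' ((4 * a + 2 : ℤ) / 4 ^ (k + 1)) σ k)
      hs.le).trans (hl _ _ _ _)
    rw [tent_half] at hd
    -- Both branches share their quarter and three-quarter points and differ at the midpoint, which
    -- yields the quadrilateral.
    have p₁ := fun b => point_update hq hq' ((4 * a + 1 : ℤ) / 4 ^ (k + 1)) σ k b (tent_quarter a)
    have p₃ := fun b =>
      point_update hq hq' ((4 * a + 3 : ℤ) / 4 ^ (k + 1)) σ k b (tent_three_quarters a)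
    have e₁ := fun b => edge (4 * a + 1) (4 * a + 2) (Function.update σ k b) (by ring)
    have e₂ := fun b => edge (4 * a + 2) (4 * a + 3) (Function.update σ k b) (by ring)
    simp only [p₁] at e₁
    simp only [p₃] at e₂
    have key := norm_sq_le_of_quadrilateral
      (mul_nonneg hs.le (mul_nonneg (mul_nonneg zero_le_two (eps_pos k).le) (by positivity)))
      (edge (4 * a) (4 * a + 1) σ rfl) (e₁ true) (e₂ true) (e₁ false) (e₂ false)
      (edge (4 * a + 3) (4 * (a + 1)) σ (by ring)) hd
    have c : ∀ m : ℤ, ((4 * m : ℤ) : ℝ) / 4 ^ (k + 1) = m / 4 ^ k := fun m => by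
      push_cast; field_simp; ring
    rw [c, c] at key
    calc _ ≤ (16 : ℝ) ^ k *
          (16 * (B / 16 ^ (k + 1)) - 2 * (s * (2 * eps k * ((4 ^ k)⁻¹ / 4))) ^ 2) := by gcongr
      _ = B - s ^ 2 / 2 * eps k ^ 2 := by
        rw [show (16 : ℝ) ^ (k + 1) = 4 ^ k * 4 ^ k * 16 by rw [← mul_pow, pow_succ]; norm_num,
          show (16 : ℝ) ^ k = 4 ^ k * 4 ^ k by rw [← mul_pow]; norm_num]
        field_simp
        ring
      _ = _ := by rw [hB]; ring

/-- Lower and upper Lipschitz bounds cannot both hold on the points of the form `point h σ`. -/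
lemma not_biLipschitz_on_points {q : ℝ≥0∞} [Fact (1 ≤ q)] (hq : 2 < q) (hq' : q < ∞)
    (g : lp (fun _ : ℕ => ℝ) q → E) {s A : ℝ} (hs : 0 < s) (hA : 0 ≤ A)
    (hl : ∀ h σ h' σ', s * dist (point hq hq' h σ) (point hq hq' h' σ') ≤
      ‖g (point hq hq' h σ) - g (point hq hq' h' σ')‖)
    (hu : ∀ h σ h' σ', ‖g (point hq hq' h σ) - g (point hq hq' h' σ')‖ ≤
      A * dist (point hq hq' h σ) (point hq hq' h' σ')) : False := by
  obtain ⟨n, hn⟩ := (Real.tendsto_sum_range_one_div_nat_succ_atTop.eventually_gt_atTop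
    ((A * ‖weightLp hq hq'‖) ^ 2 / (s ^ 2 / 2))).exists
  have h := norm_sq_edge_le hq hq' g hs hA hl hu n 0 0 fun _ => true
  rw [div_lt_iff₀ (by positivity)] at hn
  simp only [zero_add, eps_sq] at h
  have h₀ := le_trans (by positivity) h
  linarith

end Nonembedding

/-! ### Doubling. -/

/-- The magnitude of the coordinate functions of level `i`, up to a factor `4`. -/
noncomputable def scale (i : ℕ) : ℝ := eps i * (4 ^ i)⁻¹

lemma scale_pos (i : ℕ) : 0 < scale i := mul_pos (eps_pos i) (by positivity)

lemma scale_le (i : ℕ) : scale i ≤ (4 ^ i)⁻¹ :=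
  mul_le_of_le_one_left (by positivity) (eps_le_one i)

lemma scale_add_le (i n : ℕ) : scale (i + n) ≤ scale i * (1 / 4) ^ n := by
  have h : scale i * (1 / 4) ^ n = eps i * (4 ^ (i + n))⁻¹ := by
    rw [scale, pow_add, mul_inv, one_div, inv_pow, mul_assoc]
  rw [h, scale]
  gcongr
  exact eps_antitone (Nat.le_add_right i n)

lemma exists_scale_le {r : ℝ} (hr : 0 < r) : ∃ m, scale m ≤ r := by
  obtain ⟨m, hm⟩ := exists_pow_lt_of_lt_one hr (show (1 / 4 : ℝ) < 1 by norm_num)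
  refine ⟨m, (scale_le m).trans (hm.le.trans' (le_of_eq ?_))⟩
  rw [one_div, inv_pow]

/-- A geometric sequence started at position `m + 1`. -/
noncomputable def geomTail (m n : ℕ) : ℝ := if n ≤ m then 0 else (1 / 4) ^ (n - (m + 1))

lemma geomTail_nonneg (m n : ℕ) : 0 ≤ geomTail m n := by
  unfold geomTail; split_ifs <;> positivity

lemma geomTail_add (m n : ℕ) : geomTail m (n + (m + 1)) = (1 / 4) ^ n := by
  rw [geomTail, if_neg (by omega), Nat.add_sub_cancel]

lemma summable_geomTail (m : ℕ) : Summable (geomTail m) := by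
  rw [← summable_nat_add_iff (m + 1)]
  simp only [geomTail_add]
  exact summable_geometric_of_lt_one (by norm_num) (by norm_num)

lemma tsum_geomTail (m : ℕ) : ∑' n, geomTail m n = 4 / 3 := by
  rw [← (summable_geomTail m).sum_add_tsum_nat_add (m + 1)]
  simp only [geomTail_add]
  rw [tsum_geometric_of_lt_one (by norm_num) (by norm_num), Finset.sum_eq_zero]
  · norm_num
  · intro n hn
    exact if_pos (Nat.lt_succ_iff.1 (Finset.mem_range.1 hn))

lemma memℓp_geomTail (q : ℝ≥0∞) [hq : Fact (1 ≤ q)] (m : ℕ) : Memℓp (geomTail m) q := by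
  refine Memℓp.of_exponent_ge (q := 1) (memℓp_gen ?_) hq.out
  simpa using (summable_geomTail m).norm

/-- The sequence `geomTail m` as an element of `ℓ_q`. -/
noncomputable def geomTailLp (q : ℝ≥0∞) [Fact (1 ≤ q)] (m : ℕ) : lp (fun _ : ℕ => ℝ) q :=
  ⟨geomTail m, memℓp_geomTail q m⟩

lemma norm_geomTailLp_le {q : ℝ≥0∞} [hq : Fact (1 ≤ q)] (hq' : q < ∞) (m : ℕ) :
    ‖geomTailLp q m‖ ≤ 4 / 3 := by
  rw [← (lp.hasSum_single hq'.ne (geomTailLp q m)).tsum_eq, ← tsum_geomTail m]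
  refine tsum_of_norm_bounded (summable_geomTail m).hasSum fun n => ?_
  rw [lp.norm_single (zero_lt_one.trans_le hq.out)]
  exact (Real.norm_of_nonneg (geomTail_nonneg m n)).le

lemma abs_sub_le_dist_point {q : ℝ≥0∞} [Fact (1 ≤ q)] (hq : 2 < q) (hq' : q < ∞)
    (x y : ℝ) (σ τ : ℕ → Bool) : |x - y| ≤ dist (point hq hq' x σ) (point hq hq' y τ) :=
  abs_apply_sub_le_dist hq (point hq hq' x σ) (point hq hq' y τ) 0

/-- Opposite signs make the absolute values of the two coordinates add up. -/
lemma add_le_dist_point {q : ℝ≥0∞} [Fact (1 ≤ q)] (hq : 2 < q) (hq' : q < ∞)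
    (x y : ℝ) {σ τ : ℕ → Bool} {i : ℕ} (hi : σ i ≠ τ i) :
    eps i * tent i x + eps i * tent i y ≤ dist (point hq hq' x σ) (point hq hq' y τ) := by
  refine le_trans ?_ (abs_apply_sub_le_dist hq _ _ (i + 1))
  simp only [point, coords]
  cases hσ : σ i <;> cases hτ : τ i <;> simp_all only [ne_eq, not_true_eq_false, not_false_eq_true,
    Bool.false_eq_true, Bool.true_eq_false, boolSign, if_true, if_false]
  · refine le_trans (le_of_eq ?_) (neg_le_abs _); ring
  · refine le_trans (le_of_eq ?_) (le_abs_self _); ring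

/-- In a ball of radius `r`, among the levels of scale much larger than `r`, all but one have a
constant sign or vanish. -/
lemma exists_level_forall_constant {q : ℝ≥0∞} [Fact (1 ≤ q)] (hq : 2 < q) (hq' : q < ∞)
    (x : ℝ) (τ : ℕ → Bool) {r : ℝ} (m : ℕ) (hm : ∀ i < m, 16 * r < scale i) :
    ∃ J, ∀ i < m, i ≠ J →
      (∀ y σ, dist (point hq hq' y σ) (point hq hq' x τ) ≤ r → tent i y = 0) ∨
      (∀ y σ, dist (point hq hq' y σ) (point hq hq' x τ) ≤ r → σ i = τ i) := by
  classical
  set S := (Finset.range m).filter fun j =>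
    ∃ y σ, dist (point hq hq' y σ) (point hq hq' x τ) ≤ r ∧ tent j y ≠ 0 with hS
  have hout : ∀ i < m, i ∉ S →
      ∀ y σ, dist (point hq hq' y σ) (point hq hq' x τ) ≤ r → tent i y = 0 := by
    intro i hi hiS y σ hy
    by_contra h
    exact hiS (Finset.mem_filter.2 ⟨Finset.mem_range.2 hi, y, σ, hy, h⟩)
  rcases S.eq_empty_or_nonempty with hE | hne
  · exact ⟨0, fun i hi _ => .inl (hout i hi (by simp [hE]))⟩
  -- The exceptional level is the finest one below `m` whose tent is nonzero somewhere in the ball.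
  refine ⟨S.max' hne, fun i hi hiJ => ?_⟩
  set J := S.max' hne with hJ
  obtain ⟨hJm, y, σ, hy, hJy⟩ := Finset.mem_filter.1 (S.max'_mem hne)
  rw [Finset.mem_range] at hJm
  rcases lt_or_gt_of_ne hiJ with hlt | hgt
  · have hJr := hm J hJm
    have hyx := (abs_sub_le_dist_point hq hq' y x σ τ).trans hy
    have hclose : ∀ z ρ, dist (point hq hq' z ρ) (point hq hq' x τ) ≤ r → |z - y| ≤ 2 * r := by
      intro z ρ hz
      have hzx := (abs_sub_le_dist_point hq hq' z x ρ τ).trans hz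
      have := abs_sub_le z x y
      rw [abs_sub_comm x y] at this
      linarith
    have hr : 0 ≤ r := (abs_nonneg _).trans hyx
    by_cases h : (4 ^ J)⁻¹ / 4 ≤ tent i y
    · right
      -- A sign change would give `scale J / 4 ≤ r + 2 * r`, whereas `scale J / 4 > 4 * r`.
      intro z ρ hz
      by_contra hne'
      have h₁ := (add_le_dist_point hq hq' z x hne').trans hz
      have h₂ : scale J / 4 ≤ eps i * tent i y := by
        have := mul_le_mul (eps_antitone hlt.le) h (by positivity) (eps_pos i).le
        rw [scale]; linarith
      have h₃ : eps i * (tent i y - tent i z) ≤ 2 * r := by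
        have h₄ := (le_abs_self _).trans (abs_tent_sub_le i y z)
        have h₅ := hclose z ρ hz
        rw [abs_sub_comm] at h₅
        calc _ ≤ eps i * (2 * r) := by
              gcongr
              · exact (eps_pos i).le
              · linarith
          _ ≤ 2 * r := mul_le_of_le_one_left (by linarith) (eps_le_one i)
      have h₆ := mul_nonneg (eps_pos i).le (tent_nonneg i x)
      linarith
    · left
      intro z ρ hz
      refine (tent_eq_zero_or_le hlt hJy).resolve_right h ?_
      have h₁ := hclose z ρ hz
      have h₂ := scale_le J
      linarith
  · exact .inl (hout i hi fun h => (Finset.le_max' S i h).not_gt hgt)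

/-- Two points with close heights are close if their signs agree wherever they matter. -/
lemma dist_point_le_add {q : ℝ≥0∞} [Fact (1 ≤ q)] (hq : 2 < q) (hq' : q < ∞)
    {x y r : ℝ} {σ τ : ℕ → Bool} {m : ℕ} (hm : scale m ≤ r)
    (h : ∀ i < m, (tent i x = 0 ∧ tent i y = 0) ∨ σ i = τ i) :
    dist (point hq hq' x σ) (point hq hq' y τ) ≤ |x - y| * ‖weightLp hq hq'‖ + r := by
  have hr : 0 ≤ r := (scale_pos m).le.trans hm
  have hq0 := (pos_of_gt hq).ne'
  have h₁ : dist (point hq hq' x σ) (point hq hq' y τ) ≤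
      ‖|x - y| • weightLp hq hq' + (r / 2) • geomTailLp q m‖ := by
    rw [dist_eq_norm]
    refine lp.norm_mono hq0 fun n => ?_
    refine le_trans ?_ (le_abs_self _)
    change |coords x σ n - coords y τ n| ≤ |x - y| * weight n + r / 2 * geomTail m n
    have hnn : 0 ≤ r / 2 * geomTail m n := mul_nonneg (by linarith) (geomTail_nonneg m n)
    have hw : 0 ≤ |x - y| * weight n := mul_nonneg (abs_nonneg _) (weight_nonneg n)
    cases n with
    | zero => simpa [coords, weight] using hnn
    | succ i =>
      rcases lt_or_ge i m with him | him
      · rcases h i him with ⟨hx, hy⟩ | hστ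
        · simpa [coords, hx, hy] using add_nonneg hw hnn
        · have h₂ := abs_coords_sub_le x y σ (i + 1)
          have h₃ : coords y τ (i + 1) = coords y σ (i + 1) := by simp [coords, hστ]
          rw [h₃]
          linarith
      · obtain ⟨n, rfl⟩ := Nat.exists_eq_add_of_le him
        -- Two such terms give at most `scale (m + n) / 2`, hence the factor `r / 2`; the tail then
        -- has norm at most `(r / 2) * (4 / 3) ≤ r`.
        have hc : ∀ z ρ, |coords z ρ (m + n + 1)| ≤ scale (m + n) / 4 := by
          intro z ρ
          rw [coords, abs_mul, abs_boolSign, one_mul,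
            abs_of_nonneg (mul_nonneg (eps_pos _).le (tent_nonneg _ _)), scale, mul_div_assoc]
          exact mul_le_mul_of_nonneg_left (tent_le _ _) (eps_pos _).le
        have h₂ := abs_sub (coords x σ (m + n + 1)) (coords y τ (m + n + 1))
        have h₃ := hc x σ
        have h₄ := hc y τ
        have h₅ := (scale_add_le m n).trans
          (mul_le_mul_of_nonneg_right hm (show (0 : ℝ) ≤ (1 / 4) ^ n by positivity))
        rw [show m + n + 1 = n + (m + 1) by ring, geomTail_add] at *
        linarith
  refine h₁.trans ((norm_add_le _ _).trans ?_)
  rw [lp.norm_const_smul hq0, lp.norm_const_smul hq0, Real.norm_eq_abs, abs_abs,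
    Real.norm_of_nonneg (by linarith)]
  have := mul_le_mul_of_nonneg_left (norm_geomTailLp_le hq' m) (show 0 ≤ r / 2 by linarith)
  linarith

/-- One representative within the ball is chosen for each attained value of `Φ`. -/
lemma exists_finset_cover_of_map {X T : Type*} [MetricSpace X] (Φ : X → T) (F : Finset T) (x : X)
    (r ρ : ℝ) (hF : ∀ y ∈ Metric.closedBall x r, Φ y ∈ F)
    (hΦ : ∀ y ∈ Metric.closedBall x r, ∀ z ∈ Metric.closedBall x r, Φ y = Φ z → dist y z ≤ ρ) :
    ∃ c : Finset X, c.card ≤ F.card ∧ Metric.closedBall x r ⊆ ⋃ y ∈ c, Metric.closedBall y ρ := by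
  classical
  let rep : T → X := fun t =>
    if h : ∃ z ∈ Metric.closedBall x r, Φ z = t then h.choose else x
  refine ⟨F.image rep, Finset.card_image_le, fun y hy => ?_⟩
  have h : ∃ z ∈ Metric.closedBall x r, Φ z = Φ y := ⟨y, hy, rfl⟩
  have hrep : rep (Φ y) = h.choose := dif_pos h
  refine Set.mem_biUnion (Finset.mem_coe.2 (Finset.mem_image_of_mem rep (hF y hy))) ?_
  rw [hrep]
  exact hΦ y hy _ h.choose_spec.1 h.choose_spec.2.symm

/-- The set of all points of the form `point h σ`. -/
def pointSet {q : ℝ≥0∞} (hq : 2 < q) (hq' : q < ∞) : Set (lp (fun _ : ℕ => ℝ) q) :=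
  {z | ∃ h σ, z = point hq hq' h σ}

lemma abs_sub_le_of_floor_eq {u v c : ℝ} (hc : 0 < c) (h : ⌊u / c⌋ = ⌊v / c⌋) : |u - v| ≤ c := by
  have := (Int.abs_sub_lt_one_of_floor_eq_floor h).le
  rwa [← sub_div, abs_div, abs_of_pos hc, div_le_one hc] at this

lemma isDoubling_pointSet {q : ℝ≥0∞} [Fact (1 ≤ q)] (hq : 2 < q) (hq' : q < ∞) :
    IsDoubling (pointSet hq hq') := by
  obtain ⟨K, hK⟩ := exists_nat_ge (max 1 (4 * ‖weightLp hq hq'‖))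
  have hK₁ : (1 : ℝ) ≤ K := (le_max_left _ _).trans hK
  have hK₂ := (le_max_right _ _).trans hK
  choose ht sg hz using fun z : pointSet hq hq' => z.2
  let F : Finset (ℤ × Bool × (Fin 3 → Bool)) := Finset.Icc (-K : ℤ) K ×ˢ Finset.univ
  refine ⟨F.card, fun x r hr => ?_⟩
  have hex := exists_scale_le (show 0 < r / 4 by linarith)
  let m := Nat.find hex
  have hm : scale m ≤ r / 4 := Nat.find_spec hex
  have hlt : ∀ i < m, r / 4 < scale i := fun i hi => not_le.1 (Nat.find_min hex hi)
  -- Three levels shrink `scale` by at least 64, turning `r / 4` into `16 * r`.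
  have hbig : ∀ i < m - 3, 16 * r < scale i := by
    intro i hi
    have h₁ := hlt (i + 3) (by omega)
    have h₂ := scale_add_le i 3
    linarith
  obtain ⟨J, hJ⟩ := exists_level_forall_constant hq hq' (ht x) (sg x) (m - 3) hbig
  have hc : 0 < r / K := by positivity
  have hdist : ∀ y z : pointSet hq hq',
      dist y z = dist (point hq hq' (ht y) (sg y)) (point hq hq' (ht z) (sg z)) := fun y z => by
    rw [← hz y, ← hz z]; rfl
  refine exists_finset_cover_of_map
    (fun z => (⌊(ht z - ht x) / (r / K)⌋, sg z J, fun j : Fin 3 => sg z (m - 1 - j))) F x r (r / 2)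
    ?_ ?_
  · intro y hy
    have h := abs_le.1 ((abs_sub_le_dist_point hq hq' _ _ _ _).trans_eq (hdist y x).symm |>.trans hy)
    simp only [F, Finset.mem_product, Finset.mem_univ, and_true, Finset.mem_Icc]
    constructor
    · rw [Int.le_floor, le_div_iff₀ hc]
      push_cast
      rw [neg_mul, mul_div_cancel₀ _ (by positivity)]
      exact h.1
    · have : (ht y - ht x) / (r / K) ≤ (K : ℤ) := by
        rw [div_le_iff₀ hc]
        push_cast
        rw [mul_div_cancel₀ _ (by positivity)]
        exact h.2
      exact_mod_cast (Int.floor_le _).trans this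
  · intro y hy z hz' hyz
    simp only [Prod.mk.injEq] at hyz
    obtain ⟨hfl, hJyz, hwin⟩ := hyz
    have hh := abs_sub_le_of_floor_eq hc hfl
    rw [sub_sub_sub_cancel_right] at hh
    rw [Metric.mem_closedBall, hdist] at hy hz'
    rw [hdist]
    refine (dist_point_le_add hq hq' hm fun i hi => ?_).trans ?_
    · rcases lt_or_ge i (m - 3) with hi3 | hi3
      · by_cases hiJ : i = J
        · exact .inr (hiJ ▸ hJyz)
        · rcases hJ i hi3 hiJ with h | h
          · exact .inl ⟨h _ _ hy, h _ _ hz'⟩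
          · exact .inr ((h _ _ hy).trans (h _ _ hz').symm)
      · have h := congrFun hwin ⟨m - 1 - i, by omega⟩
        simp only [show m - 1 - (m - 1 - i) = i by omega] at h
        exact .inr h
    · have h₁ := mul_le_mul_of_nonneg_right hh (norm_nonneg (weightLp hq hq'))
      have h₂ : r / K * ‖weightLp hq hq'‖ ≤ r / 4 := by
        rw [div_mul_eq_mul_div, div_le_iff₀ (by positivity)]
        nlinarith
      linarith

theorem theorem1p1 (q : ℝ≥0∞) [Fact (1 ≤ q)] (hq : 2 < q) (hq' : q < ∞) :
    ∃ Z : Set (lp (fun _ : ℕ => ℝ) q), IsDoubling Z ∧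
      ∀ (d : ℕ) (f : Z → EuclideanSpace ℝ (Fin d)), ¬ IsBiLipschitzEmbedding f := by
  refine ⟨pointSet hq hq', isDoubling_pointSet hq hq', ?_⟩
  rintro d f ⟨s, D, hs, hD, hf⟩
  -- `f` lives on the subtype; its extension by zero supplies the map on all of `ℓ_q` required
  -- below.
  have hg : ∀ h σ, Function.extend Subtype.val f 0 (point hq hq' h σ) = f ⟨_, h, σ, rfl⟩ :=
    fun h σ => Subtype.val_injective.extend_apply f 0 ⟨_, h, σ, rfl⟩
  refine not_biLipschitz_on_points hq hq' (Function.extend Subtype.val f 0) (A := D * s) hs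
    (mul_nonneg (zero_le_one.trans hD) hs.le) (fun h σ h' σ' => ?_) (fun h σ h' σ' => ?_)
  · rw [hg, hg, ← dist_eq_norm]
    exact (hf ⟨_, h, σ, rfl⟩ ⟨_, h', σ', rfl⟩).1
  · rw [hg, hg, ← dist_eq_norm]
    exact (hf ⟨_, h, σ, rfl⟩ ⟨_, h', σ', rfl⟩).2
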